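/- **Model (probabilistic TSO).** A program $P$ has a finite set $\mathrm{Proc}$ of processes sharing variables with values in a data domain. Each process $p$ has local registers, a map from labels to statements, and a positive scheduling weight $w(p)$. Statements are: write $x:=e$; read $a:=x$; assignment $a:=e$; compare-and-swap $\mathrm{CAS}(x,e_0,e_1)$, which on a failed comparison either blocks or jumps to a given label; memory fence; conditional jump; termination. A configuration $\gamma$ consists of a label, a register valuation and a FIFO store buffer (a finite word of pending writes $(x,v)$) for each process, and of a memory valuation. Its size $|\gamma|$ is the total length of its buffers; $\gamma$ is *small* if $|\gamma|\le 4$, and $\Gamma^{\rm small}_P$ is the set of small configurations. In a *process transition* of $p$ the current statement of $p$ is executed: a write appends $(x,v)$ to the buffer of $p$; a read returns the value of the newest pending write of $p$ to $x$ if there is one, and the memory value otherwise; a compare-and-swap and a fence require the buffer of $p$ to be empty. A process is disabled if it has terminated or if its statement is blocked. One step of the Markov chain of $P$ from $\gamma$ has two phases. (1) An enabled process $p$ is chosen with probability $w(p)/\sum_{p'\text{ enabled in }\gamma}w(p')$ and makes its transition; if no process is enabled, the configuration does not change. (2) From the resulting configuration $\gamma_1$, a word $p_1\cdots p_k$ ($k\ge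 0$) over $\mathrm{Proc}$ is chosen uniformly among all words in which each process $p$ occurs at most as often as the length of its buffer in $\gamma_1$; then for $i=1,\dots,k$ the oldest pending write of $p_i$ is moved to the memory. Let $\mu_P^\gamma$ be the induced probability measure on the runs $\rho=\rho_0\rho_1\rho_2\cdots$ with $\rho_0=\gamma$. For a set $S$ of configurations, $\rho\models\Diamond^{\ge n}S$ means that $\rho$ visits $S$ and that its first visit is at a time $k\ge n$; $\rho\models\bigcirc\varphi$ means that $\rho_1\rho_2\cdots\models\varphi$. Put $q^*=\tfrac23$, $p^*=1-q^*=\tfrac13$ and $\mathrm{Gravity}=2\sqrt{p^*q^*}$. **Lemma.** For every program $P$, every small configuration $\gamma$ and every $n\in\mathbb N$, $$\mu_P^\gamma\bigl(\bigcirc\Diamond^{\ge n}\,\Gamma^{\rm small}_P\bigr)\le \mathrm{Gravity}^{\,n} \qquad\text{and}\qquad \mu_P^\gamma\bigl(\rho_1,\dots,\rho_n\notin\Gamma^{\rm small}_P\bigr)\le \mathrm{Gravity}^{\,n}.$$ -/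

import Mathlib

open scoped ENNReal NNReal

namespace PTSO

/-- Statements of the programming language, for a process with registers `Reg` and labels `Lbl`.
Expressions are arbitrary functions of the register valuation. -/
inductive Stmt (Var Val Reg Lbl : Type*) where
  /-- `x := e` -/
  | write (x : Var) (e : (Reg → Val) → Val)
  /-- `a := x` -/
  | read (a : Reg) (x : Var)
  /-- `a := e` -/
  | assign (a : Reg) (e : (Reg → Val) → Val)
  /-- `CAS(x, e₀, e₁)`, blocking until `x` has the value `e₀` -/
  | cas (x : Var) (e₀ e₁ : (Reg → Val) → Val)
  /-- `CAS(x, e₀, e₁)` that continues at label `l` when `x` does not have the value `e₀` -/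
  | casElse (x : Var) (e₀ e₁ : (Reg → Val) → Val) (l : Lbl)
  /-- memory fence -/
  | fence
  /-- `if c then goto l` -/
  | cond (c : (Reg → Val) → Bool) (l : Lbl)
  /-- termination -/
  | term

/-- A concurrent program, with the positive weights that its scheduler gives to the processes.
`code p l` is the statement of process `p` at label `l`, and `next p l` the label after `l`. -/
structure Program (Proc Var Val : Type*) (Reg Lbl : Proc → Type*) where
  code : ∀ p, Lbl p → Stmt Var Val (Reg p) (Lbl p)
  next : ∀ p, Lbl p → Lbl p
  weight : Proc → ℝ≥0
  weight_pos : ∀ p, 0 < weight p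

/-- Configurations: labels, registers, store buffers (oldest pending write first), memory. -/
structure Config (Proc Var Val : Type*) (Reg Lbl : Proc → Type*) where
  lbl : ∀ p, Lbl p
  regs : ∀ p, Reg p → Val
  buf : Proc → List (Var × Val)
  mem : Var → Val

section Semantics

variable {Proc Var Val : Type*} {Reg Lbl : Proc → Type*}

/-- Configurations carry the discrete σ-algebra. -/
instance : MeasurableSpace (Config Proc Var Val Reg Lbl) := ⊤

namespace Config

/-- The size of a configuration: the total number of pending writes. -/
def size [Fintype Proc] (γ : Config Proc Var Val Reg Lbl) : ℕ :=
  ∑ p, (γ.buf p).length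

open Classical in
/-- The value that process `p` reads for `x`: its own newest pending write to `x` if there is one,
and the memory value otherwise. -/
noncomputable def lookup (γ : Config Proc Var Val Reg Lbl) (p : Proc) (x : Var) : Val :=
  match (γ.buf p).reverse.find? (fun m => decide (m.1 = x)) with
  | some m => m.2
  | none => γ.mem x

open Classical in
/-- Move process `p` to label `l`. -/
noncomputable def goto (γ : Config Proc Var Val Reg Lbl) (p : Proc) (l : Lbl p) :
    Config Proc Var Val Reg Lbl :=
  { γ with lbl := Function.update γ.lbl p l }

open Classical in
/-- Set register `a` of process `p` to `v`. -/
noncomputable def setReg (γ : Config Proc Var Val Reg Lbl) (p : Proc) (a : Reg p) (v : Val) :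
    Config Proc Var Val Reg Lbl :=
  { γ with regs := Function.update γ.regs p (Function.update (γ.regs p) a v) }

open Classical in
/-- Set the memory value of `x` to `v`. -/
noncomputable def setMem (γ : Config Proc Var Val Reg Lbl) (x : Var) (v : Val) :
    Config Proc Var Val Reg Lbl :=
  { γ with mem := Function.update γ.mem x v }

open Classical in
/-- Replace the buffer of process `p`. -/
noncomputable def setBuf (γ : Config Proc Var Val Reg Lbl) (p : Proc) (b : List (Var × Val)) :
    Config Proc Var Val Reg Lbl :=
  { γ with buf := Function.update γ.buf p b }

/-- One memory update: the oldest pending write of process `p` reaches the memory. -/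
noncomputable def update (γ : Config Proc Var Val Reg Lbl) (p : Proc) :
    Option (Config Proc Var Val Reg Lbl) :=
  match γ.buf p with
  | [] => none
  | (x, v) :: b => some ((γ.setBuf p b).setMem x v)

/-- The memory updates prescribed by a word over the processes, from left to right; `none` if the
word asks for more writes of some process than are pending. -/
noncomputable def updateWord :
    List Proc → Config Proc Var Val Reg Lbl → Option (Config Proc Var Val Reg Lbl)
  | [], γ => some γ
  | p :: w, γ => (γ.update p).bind (updateWord w)

/-- The update words that can be executed from `γ`. -/
def updateWords (γ : Config Proc Var Val Reg Lbl) : Set (List Proc) :=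
  {w | (updateWord w γ).isSome}

theorem update_size [Fintype Proc] {γ γ' : Config Proc Var Val Reg Lbl} {p : Proc}
    (h : γ.update p = some γ') : γ'.size + 1 = γ.size := by
  classical
  unfold update at h
  split at h
  · cases h
  · rename_i x v b hb
    cases h
    simp only [size, setMem, setBuf]
    rw [← Finset.add_sum_erase _ _ (Finset.mem_univ p),
      ← Finset.add_sum_erase _ (fun q => (γ.buf q).length) (Finset.mem_univ p)]
    rw [Finset.sum_congr rfl (g := fun q => (γ.buf q).length)]
    · simp [hb]; omega
    · intro q hq
      simp [Function.update_of_ne (Finset.ne_of_mem_erase hq)]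

theorem length_le_size [Fintype Proc] (w : List Proc) (γ : Config Proc Var Val Reg Lbl)
    (h : w ∈ γ.updateWords) : w.length ≤ γ.size := by
  induction w generalizing γ with
  | nil => simp
  | cons p w ih =>
    simp only [updateWords, updateWord, Set.mem_ofPred_eq] at h
    rcases hu : γ.update p with _ | γ'
    · simp [hu] at h
    · rw [hu] at h
      have h1 := ih γ' h
      have h2 := update_size hu
      simp only [List.length_cons]
      omega

theorem updateWords_finite [Fintype Proc] (γ : Config Proc Var Val Reg Lbl) :
    γ.updateWords.Finite :=
  (List.finite_length_le Proc γ.size).subset fun w hw => length_le_size w γ hw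

theorem updateWords_nonempty [Fintype Proc] (γ : Config Proc Var Val Reg Lbl) :
    γ.updateWords_finite.toFinset.Nonempty :=
  ⟨[], by simp [updateWords, updateWord]⟩

/-- The update phase: an executable update word is drawn uniformly at random and executed. Thus
`γ'` is reached with probability `#{w | updateWord w γ = some γ'} / #γ.updateWords`. (The default
value `γ` of `getD` is never used.) -/
noncomputable def updatePMF [Fintype Proc] (γ : Config Proc Var Val Reg Lbl) :
    PMF (Config Proc Var Val Reg Lbl) :=
  (PMF.uniformOfFinset γ.updateWords_finite.toFinset γ.updateWords_nonempty).map
    fun w => (updateWord w γ).getD γ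

end Config

namespace Program

open Classical in
/-- The process transition of process `p` (`none` if `p` is disabled). -/
noncomputable def procStep (P : Program Proc Var Val Reg Lbl) (γ : Config Proc Var Val Reg Lbl)
    (p : Proc) : Option (Config Proc Var Val Reg Lbl) :=
  let r := γ.regs p
  let γ' := γ.goto p (P.next p (γ.lbl p))
  match P.code p (γ.lbl p) with
  | .write x e => some (γ'.setBuf p (γ.buf p ++ [(x, e r)]))
  | .read a x => some (γ'.setReg p a (γ.lookup p x))
  | .assign a e => some (γ'.setReg p a (e r))
  | .cas x e₀ e₁ =>
    if γ.buf p = [] ∧ γ.mem x = e₀ r then some (γ'.setMem x (e₁ r)) else none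
  | .casElse x e₀ e₁ l =>
    if γ.buf p = [] then
      if γ.mem x = e₀ r then some (γ'.setMem x (e₁ r)) else some (γ.goto p l)
    else none
  | .fence => if γ.buf p = [] then some γ' else none
  | .cond c l => if c r then some (γ.goto p l) else some γ'
  | .term => none

/-- Process `p` is enabled in `γ`. -/
def Enabled (P : Program Proc Var Val Reg Lbl) (γ : Config Proc Var Val Reg Lbl) (p : Proc) :
    Prop :=
  (P.procStep γ p).isSome

open Classical in
/-- The weight of `p` if `p` is enabled in `γ`, and `0` otherwise. -/
noncomputable def enabledWeight (P : Program Proc Var Val Reg Lbl)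
    (γ : Config Proc Var Val Reg Lbl) (p : Proc) : ℝ≥0∞ :=
  if P.Enabled γ p then (P.weight p : ℝ≥0∞) else 0

theorem tsum_enabledWeight_ne_zero (P : Program Proc Var Val Reg Lbl)
    (γ : Config Proc Var Val Reg Lbl) (h : ∃ p, P.Enabled γ p) :
    ∑' p, P.enabledWeight γ p ≠ 0 := by
  obtain ⟨p, hp⟩ := h
  intro h0
  have h1 := ENNReal.tsum_eq_zero.1 h0 p
  simp [enabledWeight, hp, (P.weight_pos p).ne'] at h1

theorem tsum_enabledWeight_ne_top [Fintype Proc] (P : Program Proc Var Val Reg Lbl)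
    (γ : Config Proc Var Val Reg Lbl) : ∑' p, P.enabledWeight γ p ≠ ∞ := by
  rw [tsum_fintype]
  refine ENNReal.sum_ne_top.2 fun p _ => ?_
  unfold enabledWeight
  split <;> simp

open Classical in
/-- The process phase: an enabled process is drawn with probability proportional to its weight and
makes its transition; if no process is enabled, the configuration stays the same. (The default
value `γ` of `getD` is never used.) -/
noncomputable def procPMF [Fintype Proc] (P : Program Proc Var Val Reg Lbl)
    (γ : Config Proc Var Val Reg Lbl) : PMF (Config Proc Var Val Reg Lbl) :=
  if h : ∃ p, P.Enabled γ p then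
    (PMF.normalize (P.enabledWeight γ) (P.tsum_enabledWeight_ne_zero γ h)
      (P.tsum_enabledWeight_ne_top γ)).map fun p => (P.procStep γ p).getD γ
  else PMF.pure γ

/-- One step of the Markov chain of `P`: a process phase followed by an update phase. -/
noncomputable def stepPMF [Fintype Proc] (P : Program Proc Var Val Reg Lbl)
    (γ : Config Proc Var Val Reg Lbl) : PMF (Config Proc Var Val Reg Lbl) :=
  (P.procPMF γ).bind Config.updatePMF

/-- The Markov chain of `P` as a transition kernel that sees the whole history but depends on its
last configuration only. -/
noncomputable def stepKernel [Fintype Proc] (P : Program Proc Var Val Reg Lbl) (n : ℕ) :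
    ProbabilityTheory.Kernel (Finset.Iic n → Config Proc Var Val Reg Lbl)
      (Config Proc Var Val Reg Lbl) where
  toFun h := (P.stepPMF (h ⟨n, Finset.mem_Iic.2 le_rfl⟩)).toMeasure
  measurable' :=
    (measurable_from_top (f := fun γ => (P.stepPMF γ).toMeasure)).comp
      (measurable_pi_apply (⟨n, Finset.mem_Iic.2 le_rfl⟩ : Finset.Iic n))

instance [Fintype Proc] (P : Program Proc Var Val Reg Lbl) (n : ℕ) :
    ProbabilityTheory.IsMarkovKernel (P.stepKernel n) :=
  ⟨fun h => PMF.toMeasure.isProbabilityMeasure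
    (P.stepPMF (h ⟨n, Finset.mem_Iic.2 le_rfl⟩))⟩

/-- The probability measure on the runs `ρ 0, ρ 1, ρ 2, …` of the Markov chain of `P` that start
in `ρ 0 = γ`. -/
noncomputable def runMeasure [Fintype Proc] (P : Program Proc Var Val Reg Lbl)
    (γ : Config Proc Var Val Reg Lbl) :
    MeasureTheory.Measure (ℕ → Config Proc Var Val Reg Lbl) :=
  ProbabilityTheory.Kernel.traj (X := fun _ => Config Proc Var Val Reg Lbl) P.stepKernel 0
    fun _ => γ

end Program

/-- The small configurations. -/
def small [Fintype Proc] : Set (Config Proc Var Val Reg Lbl) :=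
  {γ | γ.size ≤ 4}

end Semantics

/-- `◇^{=k} S`: the run visits `S` at time `k`, and not before. -/
def eventuallyEq {C : Type*} (k : ℕ) (S : Set C) : Set (ℕ → C) :=
  {ρ | ρ k ∈ S ∧ ∀ j < k, ρ j ∉ S}

/-- `◇^{≥n} S`: the run visits `S`, and the first visit is at time `n` or later. -/
def eventuallyGe {C : Type*} (n : ℕ) (S : Set C) : Set (ℕ → C) :=
  {ρ | ∃ k ≥ n, ρ ∈ eventuallyEq k S}

/-- `○ A`: the run without its first configuration is in `A`. -/
def next {C : Type*} (A : Set (ℕ → C)) : Set (ℕ → C) :=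
  {ρ | (fun i => ρ (i + 1)) ∈ A}

/-- The runs that are outside `S` at each of the `n` times `1, …, n`. -/
def avoidsFor {C : Type*} (n : ℕ) (S : Set C) : Set (ℕ → C) :=
  {ρ | ∀ i, 1 ≤ i → i ≤ n → ρ i ∉ S}

/-- `q* = 2/3` -/
noncomputable def qStar : ℝ := 2 / 3

/-- `p* = 1 - q*` -/
noncomputable def pStar : ℝ := 1 - qStar

/-- The gravity parameter `2 √(p* q*)`. -/
noncomputable def gravity : ℝ := 2 * Real.sqrt (pStar * qStar)

end PTSO

/-! The size drifts downwards. An update word of length `k` leaves `m - k` of `m` pending writes.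
Every executable word shorter than `m` extends by a letter, so there are at least as many executable
words of length `k + 1` as of length `k`. A uniform word thus flushes at least half of the writes on
average (`tsum_updatePMF_mul_size_le`). A process transition adds at most one write, so one step
takes size `s` to expected size at most `(s + 1) / 2`.

This is at most `5 / 2` from a small configuration, and at most `3 / 5 * s` when `5 ≤ s`. Iterating
with the Markov property bounds the expected size on the runs that stay large
(`setLIntegral_avoidsFor_le`). Markov's inequality turns this into the probability bound `(3 / 5) ^
n`, and `3 / 5` is below the gravity parameter. The first event of the theorem is contained in the
second. -/

/-! ### A Chebyshev-type sum inequality -/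

theorem two_mul_sum_mul_sub_le (N : ℕ → ℕ) (m : ℕ) (hN : ∀ k < m, N k ≤ N (k + 1)) :
    2 * ∑ k ∈ Finset.range (m + 1), N k * (m - k) ≤ m * ∑ k ∈ Finset.range (m + 1), N k := by
  have hmono : ∀ i j, i ≤ j → j ≤ m → N i ≤ N j := by
    intro i j hij
    induction j, hij using Nat.le_induction with
    | base => intro _; exact le_rfl
    | succ j _ ih => intro hj; exact (ih (by omega)).trans (hN j (by omega))
  have h1 := Finset.sum_range_reflect (fun k => N k * (m - k)) (m + 1)
  have h2 := Finset.sum_range_reflect N (m + 1)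
  simp only [Nat.add_sub_cancel] at h1 h2
  -- Pair `k` with `j = m - k`: the termwise difference of the two sides is `(j - k) * (N j - N k)`,
  -- nonnegative by monotonicity.
  have key : ∑ k ∈ Finset.range (m + 1), 2 * (N k * (m - k) + N (m - k) * (m - (m - k))) ≤
      ∑ k ∈ Finset.range (m + 1), m * (N k + N (m - k)) := by
    refine Finset.sum_le_sum fun k hk => ?_
    have hk' : k ≤ m := by simpa [Nat.lt_succ_iff] using hk
    obtain ⟨j, rfl⟩ := Nat.exists_eq_add_of_le hk'
    simp only [Nat.add_sub_cancel_left, Nat.add_sub_cancel]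
    rcases le_total k j with h | h
    · have := hmono k j h (by omega)
      nlinarith
    · have := hmono j k h (by omega)
      nlinarith
  rw [← Finset.mul_sum, ← Finset.mul_sum, Finset.sum_add_distrib, Finset.sum_add_distrib,
    h1, h2] at key
  linarith

/-! ### Expectations under a `PMF` -/

theorem PMF.lintegral_toMeasure {α : Type*} [MeasurableSpace α] (p : PMF α) {f : α → ℝ≥0∞}
    (hf : Measurable f) : ∫⁻ a, f a ∂p.toMeasure = ∑' a, p a * f a := by
  have h : p.toMeasure = MeasureTheory.Measure.sum fun a => p a • MeasureTheory.Measure.dirac a := by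
    ext s hs
    rw [p.toMeasure_apply hs, MeasureTheory.Measure.sum_apply _ hs]
    refine tsum_congr fun a => ?_
    by_cases ha : a ∈ s <;> simp [MeasureTheory.Measure.dirac_apply' _ hs, ha]
  rw [h, MeasureTheory.lintegral_sum_measure]
  exact tsum_congr fun a => by
    rw [MeasureTheory.lintegral_smul_measure, MeasureTheory.lintegral_dirac' _ hf, smul_eq_mul]

theorem PMF.tsum_bind_mul {α β : Type*} (p : PMF α) (q : α → PMF β) (f : β → ℝ≥0∞) :
    ∑' b, p.bind q b * f b = ∑' a, p a * ∑' b, q a b * f b := by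
  simp_rw [PMF.bind_apply, ← ENNReal.tsum_mul_right, ← ENNReal.tsum_mul_left]
  rw [ENNReal.tsum_comm]
  simp_rw [mul_assoc]

theorem PMF.tsum_pure_mul {β : Type*} (b : β) (f : β → ℝ≥0∞) :
    ∑' b', PMF.pure b b' * f b' = f b := by
  rw [tsum_eq_single b]
  · simp
  · intro b' h; simp [PMF.pure_apply, h]

theorem PMF.tsum_map_mul {α β : Type*} (p : PMF α) (g : α → β) (f : β → ℝ≥0∞) :
    ∑' b, p.map g b * f b = ∑' a, p a * f (g a) := by
  rw [← PMF.bind_pure_comp, PMF.tsum_bind_mul]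
  exact tsum_congr fun a => by rw [Function.comp_apply, PMF.tsum_pure_mul]

/-! ### The events on runs -/

namespace PTSO

/-- Exhibits the event as one about the first `n + 1` configurations, the form in which the Markov
property applies. -/
theorem avoidsFor_eq_preimage {C : Type*} (n : ℕ) (S : Set C) :
    avoidsFor n S = Preorder.frestrictLe (π := fun _ => C) n ⁻¹'
      {h | ∀ i : Finset.Iic n, 1 ≤ (i : ℕ) → h i ∉ S} := by
  ext ρ
  simp only [avoidsFor, Set.mem_ofPred_eq, Set.mem_preimage, Subtype.forall, Finset.mem_Iic,
    Preorder.frestrictLe_apply]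
  exact ⟨fun h i h₁ h₂ => h i h₂ h₁, fun h i h₁ h₂ => h i h₂ h₁⟩

theorem avoidsFor_antitone {C : Type*} (S : Set C) : Antitone fun n => avoidsFor n S :=
  fun _ _ h _ hρ i h₁ h₂ => hρ i h₁ (h₂.trans h)

/-- A first visit of the shifted run at time `k ≥ n` excludes visits of the run itself at times `1,
…, k`. -/
theorem next_eventuallyGe_subset_avoidsFor {C : Type*} (n : ℕ) (S : Set C) :
    next (eventuallyGe n S) ⊆ avoidsFor n S := by
  rintro ρ ⟨k, hk, -, h⟩ i h₁ h₂
  simpa only [Nat.sub_add_cancel h₁] using h (i - 1) (by omega)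

variable {Proc Var Val : Type*} {Reg Lbl : Proc → Type*}

instance : DiscreteMeasurableSpace (Config Proc Var Val Reg Lbl) := ⟨fun _ => trivial⟩

theorem measurableSet_avoidsFor (n : ℕ) (S : Set (Config Proc Var Val Reg Lbl)) :
    MeasurableSet (avoidsFor n S) := by
  simp only [avoidsFor, Set.ofPred_forall]
  refine .iInter fun i => .iInter fun _ => .iInter fun _ => ?_
  exact measurableSet_preimage (t := Sᶜ) (measurable_pi_apply i) .of_discrete

/-! ### The update phase -/

namespace Config

theorem updateWord_append (w v : List Proc) (γ : Config Proc Var Val Reg Lbl) :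
    updateWord (w ++ v) γ = (updateWord w γ).bind (updateWord v) := by
  induction w generalizing γ with
  | nil => rfl
  | cons p w ih =>
    simp only [List.cons_append, updateWord, Option.bind_assoc]
    congr 1
    funext γ'
    exact ih γ'

variable [Fintype Proc]

theorem updateWord_size {w : List Proc} {γ γ' : Config Proc Var Val Reg Lbl}
    (h : updateWord w γ = some γ') : γ'.size + w.length = γ.size := by
  induction w generalizing γ with
  | nil => cases h; simp
  | cons p w ih =>
    obtain ⟨γ₁, h₁, h₂⟩ := Option.bind_eq_some_iff.1 h
    have := ih h₂
    have := update_size h₁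
    simp only [List.length_cons]
    omega

theorem exists_update_of_size_pos {γ : Config Proc Var Val Reg Lbl} (h : 0 < γ.size) :
    ∃ p, (γ.update p).isSome := by
  obtain ⟨p, -, hp⟩ := Finset.exists_ne_zero_of_sum_ne_zero h.ne'
  refine ⟨p, ?_⟩
  unfold update
  split
  · rename_i hb; simp [hb] at hp
  · rfl

/-- The update words that can be executed from `γ`, as a finite set. -/
noncomputable def words (γ : Config Proc Var Val Reg Lbl) : Finset (List Proc) :=
  γ.updateWords_finite.toFinset

theorem mem_words {γ : Config Proc Var Val Reg Lbl} {w : List Proc} :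
    w ∈ γ.words ↔ (updateWord w γ).isSome := by
  simp [words, updateWords]

theorem exists_append_mem_words {γ : Config Proc Var Val Reg Lbl} {w : List Proc}
    (hw : w ∈ γ.words) (h : w.length < γ.size) : ∃ p, w ++ [p] ∈ γ.words := by
  obtain ⟨γ', hγ'⟩ := Option.isSome_iff_exists.1 (mem_words.1 hw)
  have hs := updateWord_size hγ'
  obtain ⟨p, hp⟩ := exists_update_of_size_pos (γ := γ') (by omega)
  obtain ⟨γ₂, h₂⟩ := Option.isSome_iff_exists.1 hp
  exact ⟨p, mem_words.2 (by simp [updateWord_append, hγ', updateWord, h₂])⟩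

/-- Appending a chosen executable letter is injective, since deleting the last letter recovers the
word, whatever the choice. -/
theorem card_words_length_le_succ (γ : Config Proc Var Val Reg Lbl) {k : ℕ} (hk : k < γ.size) :
    (γ.words.filter fun w => w.length = k).card ≤
      (γ.words.filter fun w => w.length = k + 1).card := by
  obtain ⟨p₀, -⟩ := exists_update_of_size_pos (γ := γ) (by omega)
  have : Nonempty Proc := ⟨p₀⟩
  choose! p hp using fun (w : List Proc) (hw : w ∈ γ.words ∧ w.length < γ.size) =>
    exists_append_mem_words hw.1 hw.2
  refine Finset.card_le_card_of_injOn (fun w => w ++ [p w]) (fun w hw => ?_) fun w _ w' _ h => ?_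
  · obtain ⟨h₁, h₂⟩ := Finset.mem_filter.1 hw
    exact Finset.mem_filter.2 ⟨hp w ⟨h₁, by omega⟩, by simp [h₂]⟩
  · exact (List.append_inj' h rfl).1

/-- Grouping the words by length turns the total remaining size into a sum weighted by nondecreasing
counts, to which the Chebyshev-type inequality applies. -/
theorem two_mul_sum_words_le (γ : Config Proc Var Val Reg Lbl) :
    2 * ∑ w ∈ γ.words, ((updateWord w γ).getD γ).size ≤ γ.words.card * γ.size := by
  have hmaps : ∀ w ∈ γ.words, w.length ∈ Finset.range (γ.size + 1) := fun w hw =>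
    Finset.mem_range.2 (Nat.lt_succ_of_le (length_le_size w γ (mem_words.1 hw)))
  have hsum : ∑ w ∈ γ.words, ((updateWord w γ).getD γ).size =
      ∑ k ∈ Finset.range (γ.size + 1),
        (γ.words.filter fun w => w.length = k).card * (γ.size - k) := by
    rw [← Finset.sum_fiberwise_of_maps_to hmaps]
    refine Finset.sum_congr rfl fun k _ => ?_
    rw [← smul_eq_mul, ← Finset.sum_const]
    refine Finset.sum_congr rfl fun w hw => ?_
    obtain ⟨h₁, h₂⟩ := Finset.mem_filter.1 hw
    obtain ⟨γ', hγ'⟩ := Option.isSome_iff_exists.1 (mem_words.1 h₁)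
    have := updateWord_size hγ'
    simp only [hγ', Option.getD_some]
    omega
  rw [hsum, Finset.card_eq_sum_card_fiberwise hmaps, mul_comm (Finset.sum _ _)]
  exact two_mul_sum_mul_sub_le _ _ fun k hk => γ.card_words_length_le_succ hk

/-- The update phase at least halves the expected size. -/
theorem tsum_updatePMF_mul_size_le (γ : Config Proc Var Val Reg Lbl) :
    ∑' γ', γ.updatePMF γ' * (γ'.size : ℝ≥0∞) ≤ (γ.size : ℝ≥0∞) / 2 := by
  rw [updatePMF, PMF.tsum_map_mul, tsum_eq_sum (s := γ.words)]
  · have h : ∀ w ∈ γ.words, PMF.uniformOfFinset γ.updateWords_finite.toFinset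
        γ.updateWords_nonempty w * (((updateWord w γ).getD γ).size : ℝ≥0∞) =
        (γ.words.card : ℝ≥0∞)⁻¹ * (((updateWord w γ).getD γ).size : ℝ≥0∞) := fun w hw => by
      rw [PMF.uniformOfFinset_apply_of_mem γ.updateWords_nonempty hw]; rfl
    rw [Finset.sum_congr rfl h, ← Finset.mul_sum]
    have h0 : (γ.words.card : ℝ≥0∞) ≠ 0 :=
      Nat.cast_ne_zero.2 (Finset.card_pos.2 γ.updateWords_nonempty).ne'
    have h2 : 2 * ∑ w ∈ γ.words, (((updateWord w γ).getD γ).size : ℝ≥0∞) ≤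
        γ.words.card * (γ.size : ℝ≥0∞) := mod_cast γ.two_mul_sum_words_le
    rw [ENNReal.le_div_iff_mul_le (by simp) (by simp), mul_assoc, mul_comm _ 2]
    calc (γ.words.card : ℝ≥0∞)⁻¹ * _ ≤ (γ.words.card : ℝ≥0∞)⁻¹ * (γ.words.card * γ.size) := by
          gcongr
      _ = γ.size := by
          rw [← mul_assoc, ENNReal.inv_mul_cancel h0 (ENNReal.natCast_ne_top _), one_mul]
  · intro w hw
    rw [PMF.uniformOfFinset_apply_of_notMem γ.updateWords_nonempty hw, zero_mul]

end Config

/-! ### The process phase and the drift of one step -/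

namespace Program

variable [Fintype Proc] (P : Program Proc Var Val Reg Lbl)

theorem procStep_size_le {γ γ' : Config Proc Var Val Reg Lbl} {p : Proc}
    (h : P.procStep γ p = some γ') : γ'.size ≤ γ.size + 1 := by
  classical
  unfold procStep at h
  dsimp only at h
  split at h
  · cases h
    simp only [Config.size, Config.setBuf, Config.goto]
    rw [← Finset.add_sum_erase _ _ (Finset.mem_univ p),
      ← Finset.add_sum_erase _ (fun q => (γ.buf q).length) (Finset.mem_univ p)]
    rw [Finset.sum_congr rfl (g := fun q => (γ.buf q).length)]
    · simp; omega
    · intro q hq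
      simp [Function.update_of_ne (Finset.ne_of_mem_erase hq)]
  all_goals
    repeat' split at h
    all_goals cases h
    all_goals exact Nat.le_succ _

theorem tsum_procPMF_mul_size_le (γ : Config Proc Var Val Reg Lbl) :
    ∑' γ', P.procPMF γ γ' * ((γ'.size : ℝ≥0∞) / 2) ≤ ((γ.size : ℝ≥0∞) + 1) / 2 := by
  unfold procPMF
  split
  · rw [PMF.tsum_map_mul]
    calc _ ≤ ∑' p, PMF.normalize (P.enabledWeight γ) _ (P.tsum_enabledWeight_ne_top γ) p *
          (((γ.size : ℝ≥0∞) + 1) / 2) := by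
          refine ENNReal.tsum_le_tsum fun p => ?_
          gcongr
          rcases h : P.procStep γ p with _ | γ'
          -- A disabled process has weight 0, but the bound holds for the default value `γ` in any
          -- case.
          · simp
          · exact mod_cast P.procStep_size_le h
      _ = _ := by rw [ENNReal.tsum_mul_right, PMF.tsum_coe, one_mul]
  · rw [PMF.tsum_pure_mul]
    gcongr
    exact le_self_add

theorem lintegral_stepPMF_size_le (γ : Config Proc Var Val Reg Lbl) :
    ∫⁻ γ', (γ'.size : ℝ≥0∞) ∂(P.stepPMF γ).toMeasure ≤ ((γ.size : ℝ≥0∞) + 1) / 2 := by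
  rw [PMF.lintegral_toMeasure _ .of_discrete, stepPMF, PMF.tsum_bind_mul]
  refine le_trans (ENNReal.tsum_le_tsum fun γ' => ?_) (P.tsum_procPMF_mul_size_le γ)
  gcongr
  exact γ'.tsum_updatePMF_mul_size_le

/-! ### Iteration along the run -/

open MeasureTheory ProbabilityTheory

/-- The Markov property for events about the first `n + 1` configurations. -/
theorem setLIntegral_runMeasure_succ (γ : Config Proc Var Val Reg Lbl) (n : ℕ)
    {A : Set (Finset.Iic n → Config Proc Var Val Reg Lbl)} (hA : MeasurableSet A)
    (g : Config Proc Var Val Reg Lbl → ℝ≥0∞) :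
    ∫⁻ ρ in Preorder.frestrictLe n ⁻¹' A, g (ρ (n + 1)) ∂P.runMeasure γ =
      ∫⁻ ρ in Preorder.frestrictLe n ⁻¹' A, ∫⁻ γ', g γ' ∂(P.stepPMF (ρ n)).toMeasure
        ∂P.runMeasure γ := by
  have hg : Measurable g := .of_discrete
  have hr : Measurable (Preorder.frestrictLe (π := fun _ => Config Proc Var Val Reg Lbl) n) :=
    Preorder.measurable_frestrictLe n
  have hF : Measurable fun z : (Finset.Iic n → Config Proc Var Val Reg Lbl) ×
      Config Proc Var Val Reg Lbl => A.indicator (fun _ => g z.2) z.1 :=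
    Measurable.indicator (s := Prod.fst ⁻¹' A) (hg.comp measurable_snd) (measurable_fst hA)
  -- The law of the first `n + 1` configurations, composed with the step kernel, is their joint law
  -- with the next configuration.
  have h1 := congrArg (fun μ => ∫⁻ z, A.indicator (fun _ => g z.2) z.1 ∂μ)
    (Kernel.partialTraj_compProd_eq_map_traj (X := fun _ => Config Proc Var Val Reg Lbl)
      (κ := P.stepKernel) (zero_le (a := n)) (x₀ := fun _ => γ))
  rw [lintegral_map hF (by fun_prop), Measure.lintegral_compProd hF,
    ← Kernel.traj_map_frestrictLe_apply, lintegral_map (hF.lintegral_kernel_prod_right') hr] at h1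
  rw [← lintegral_indicator (hr hA), ← lintegral_indicator (hr hA)]
  refine h1.symm.trans (lintegral_congr fun ρ => ?_)
  by_cases h : Preorder.frestrictLe n ρ ∈ A
  · simp [h, stepKernel]
  · simp [h]

theorem setLIntegral_avoidsFor_succ_le (γ : Config Proc Var Val Reg Lbl) (n : ℕ) :
    ∫⁻ ρ in avoidsFor (n + 1) small, ((ρ (n + 1)).size : ℝ≥0∞) ∂P.runMeasure γ ≤
      ∫⁻ ρ in avoidsFor n small, (((ρ n).size : ℝ≥0∞) + 1) / 2 ∂P.runMeasure γ := by
  have hA : MeasurableSet {h : Finset.Iic n → Config Proc Var Val Reg Lbl |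
      ∀ i : Finset.Iic n, 1 ≤ (i : ℕ) → h i ∉ small} := by
    simp only [Set.ofPred_forall]
    refine .iInter fun i => .iInter fun _ => ?_
    exact measurableSet_preimage (t := smallᶜ) (measurable_pi_apply i) .of_discrete
  -- Dropping the condition at time `n + 1` enlarges the integral and leaves an event decided by
  -- time `n`.
  calc _ ≤ ∫⁻ ρ in avoidsFor n small, ((ρ (n + 1)).size : ℝ≥0∞) ∂P.runMeasure γ :=
        lintegral_mono_set (avoidsFor_antitone _ n.le_succ)
    _ = ∫⁻ ρ in avoidsFor n small, ∫⁻ γ', (γ'.size : ℝ≥0∞) ∂(P.stepPMF (ρ n)).toMeasure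
          ∂P.runMeasure γ := by
        rw [avoidsFor_eq_preimage]
        exact P.setLIntegral_runMeasure_succ γ n hA fun γ' => (γ'.size : ℝ≥0∞)
    _ ≤ _ := lintegral_mono fun ρ => P.lintegral_stepPMF_size_le (ρ n)

instance (γ : Config Proc Var Val Reg Lbl) : IsProbabilityMeasure (P.runMeasure γ) :=
  inferInstanceAs (IsProbabilityMeasure (Kernel.traj _ 0 _))

theorem runMeasure_ae_zero (γ : Config Proc Var Val Reg Lbl) :
    ∀ᵐ ρ ∂P.runMeasure γ, ρ 0 = γ := by
  have h := Kernel.traj_map_frestrictLe_apply (X := fun _ => Config Proc Var Val Reg Lbl)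
    (κ := P.stepKernel) (a := 0) (b := 0) (fun _ => γ)
  rw [Kernel.partialTraj_self, Kernel.id_apply] at h
  have hm : MeasurableSet {x : Finset.Iic 0 → Config Proc Var Val Reg Lbl |
      x ⟨0, Finset.mem_Iic.2 le_rfl⟩ = γ} :=
    measurableSet_preimage (t := {γ})
      (measurable_pi_apply (⟨0, Finset.mem_Iic.2 le_rfl⟩ : Finset.Iic 0)) .of_discrete
  have h2 : ∀ᵐ x ∂(P.runMeasure γ).map (Preorder.frestrictLe 0),
      x ⟨0, Finset.mem_Iic.2 le_rfl⟩ = γ := by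
    rw [runMeasure, h, ae_dirac_iff hm]
  exact ae_of_ae_map (Preorder.measurable_frestrictLe 0).aemeasurable h2

/-- The first step starts at size at most 4 and contributes `5 / 2`; each later step starts outside
the small set and contributes a factor `3 / 5`. -/
theorem setLIntegral_avoidsFor_le {γ : Config Proc Var Val Reg Lbl} (hγ : γ ∈ small) (n : ℕ) :
    ∫⁻ ρ in avoidsFor (n + 1) small, ((ρ (n + 1)).size : ℝ≥0∞) ∂P.runMeasure γ ≤
      (3 / 5) ^ n * (5 / 2) := by
  induction n with
  | zero =>
    refine (P.setLIntegral_avoidsFor_succ_le γ 0).trans ?_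
    refine (setLIntegral_le_lintegral _ _).trans ?_
    have h : ∀ᵐ ρ ∂P.runMeasure γ, (((ρ 0).size : ℝ≥0∞) + 1) / 2 ≤ 5 / 2 := by
      filter_upwards [P.runMeasure_ae_zero γ] with ρ hρ
      rw [hρ]
      gcongr
      have : γ.size + 1 ≤ 5 := Nat.succ_le_succ hγ
      exact mod_cast this
    refine (lintegral_mono_ae h).trans ?_
    simp
  | succ n ih =>
    refine (P.setLIntegral_avoidsFor_succ_le γ (n + 1)).trans ?_
    -- `(s + 1) / 2 ≤ 3 / 5 * s` holds exactly when `5 ≤ s`, which is what being outside the small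
    -- set gives.
    have h : ∀ ρ ∈ avoidsFor (n + 1) (small : Set (Config Proc Var Val Reg Lbl)),
        (((ρ (n + 1)).size : ℝ≥0∞) + 1) / 2 ≤ 3 / 5 * ((ρ (n + 1)).size : ℝ≥0∞) := fun ρ hρ => by
      have h4 : ¬ (ρ (n + 1)).size ≤ 4 := hρ (n + 1) (by omega) le_rfl
      have h5 : 5 ≤ (ρ (n + 1)).size := by omega
      generalize (ρ (n + 1)).size = s at h5
      rw [← ENNReal.toReal_le_toReal (by finiteness) (by finiteness)]
      have : (5 : ℝ) ≤ s := mod_cast h5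
      simp [ENNReal.toReal_add]
      linarith
    refine (setLIntegral_mono' (measurableSet_avoidsFor _ _) h).trans ?_
    rw [lintegral_const_mul' _ _ (by finiteness), pow_succ', mul_assoc]
    gcongr

/-- Markov's inequality at threshold 5 gives `(3 / 5) ^ n / 2`, and `1 / 2 ≤ 3 / 5`. -/
theorem runMeasure_avoidsFor_le {γ : Config Proc Var Val Reg Lbl} (hγ : γ ∈ small) (n : ℕ) :
    P.runMeasure γ (avoidsFor (n + 1) small) ≤ (3 / 5) ^ (n + 1) := by
  have h : 5 * P.runMeasure γ (avoidsFor (n + 1) small) ≤ (3 / 5) ^ n * (5 / 2) := by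
    rw [← setLIntegral_const]
    refine le_trans (setLIntegral_mono' (measurableSet_avoidsFor _ _) fun ρ hρ => ?_)
      (P.setLIntegral_avoidsFor_le hγ n)
    have h4 : ¬ (ρ (n + 1)).size ≤ 4 := hρ (n + 1) (by omega) le_rfl
    have h5 : 5 ≤ (ρ (n + 1)).size := by omega
    exact mod_cast h5
  have hfin : P.runMeasure γ (avoidsFor (n + 1) small) ≠ ∞ := measure_ne_top _ _
  rw [← ENNReal.toReal_le_toReal (by finiteness) (by finiteness)] at h ⊢
  simp only [ENNReal.toReal_mul, ENNReal.toReal_pow, ENNReal.toReal_div,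
    ENNReal.toReal_ofNat] at h ⊢
  have : (0 : ℝ) ≤ (3 / 5) ^ n := by positivity
  rw [pow_succ]
  linarith

end Program

/-- The gravity parameter is `2√2/3 ≈ 0.94`, so there is ample slack. -/
theorem three_fifths_le_gravity : 3 / 5 ≤ gravity := by
  have : (3 / 10 : ℝ) ≤ Real.sqrt (pStar * qStar) := by
    apply Real.le_sqrt_of_sq_le
    norm_num [pStar, qStar]
  unfold gravity
  linarith

end PTSO

theorem mainTheorem7 {Proc Var Val : Type*} {Reg Lbl : Proc → Type*} [Fintype Proc]
    (P : PTSO.Program Proc Var Val Reg Lbl) (γ : PTSO.Config Proc Var Val Reg Lbl)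
    (hγ : γ ∈ PTSO.small) (n : ℕ) :
    P.runMeasure γ (PTSO.next (PTSO.eventuallyGe n PTSO.small)) ≤
        ENNReal.ofReal (PTSO.gravity ^ n) ∧
      P.runMeasure γ (PTSO.avoidsFor n PTSO.small) ≤ ENNReal.ofReal (PTSO.gravity ^ n) := by
  have h : P.runMeasure γ (PTSO.avoidsFor n PTSO.small) ≤ ENNReal.ofReal (PTSO.gravity ^ n) := by
    cases n with
    | zero => simpa using MeasureTheory.prob_le_one
    | succ n =>
      refine (P.runMeasure_avoidsFor_le hγ n).trans ?_
      rw [ENNReal.ofReal_pow (by linarith [PTSO.three_fifths_le_gravity])]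
      gcongr
      rw [ENNReal.le_ofReal_iff_toReal_le (by finiteness)
        (by linarith [PTSO.three_fifths_le_gravity])]
      simpa using PTSO.three_fifths_le_gravity
  exact ⟨(MeasureTheory.measure_mono
    (PTSO.next_eventuallyGe_subset_avoidsFor n PTSO.small)).trans h, h⟩
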